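/- Let $X$ be a non-empty compact metric space and let $\mathcal{K}(X)$ be the set of non-empty compact subsets of $X$ with the Hausdorff metric; give $\mathcal{K}(X)\times(0,1)$ the product topology. For $E\subseteq X$ and $r>0$ let $N(E,r)$ be the minimal number of closed balls of radius $r$, with centres in $X$, needed to cover $E$, and let $B(x,R)$ be the open ball of centre $x$ and radius $R$. For $F\in\mathcal{K}(X)$ and $\theta\in(0,1)$, the Assouad spectrum is \[ \dim_{\mathrm A}^{\theta}F=\inf\Big\{\alpha\in\mathbb{R} : (\exists C>0)(\exists\rho>0)(\forall\,0<R\le\rho)(\forall x\in F)\ \ N\big(B(x,R)\cap F,\,R^{1/\theta}\big)\le C\Big(\frac{R}{R^{1/\theta}}\Big)^{\alpha}\Big\}, \] an element of the extended real line $[-\infty,\infty]$, with value $+\infty$ if no such $\alpha$ exists. A function between two topological spaces is of Baire class $0$ if it is continuous, and of Baire class $n+1$ if it is the pointwise limit of a sequence of functions of Baire class $n$. Then the map $\Delta_{\mathrm A}:\mathcal{K}(X)\times(0,1)\to[-\infty,\infty]$, $\Delta_{\mathrm A}(F,\theta)=\dim_{\mathrm A}^{\theta}F$, is of Baire class $2$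 and Borel measurable. If all its values are finite, then it is also of Baire class $2$ and Borel measurable as a function into $\mathbb{R}$. In general $\Delta_{\mathrm A}$ is not of Baire class $1$: there is a non-empty compact metric space $X$ for which all values of $\Delta_{\mathrm A}$ are finite and $\Delta_{\mathrm A}$ is not of Baire class $1$, neither as a function into $\mathbb{R}$ nor as a function into $[-\infty,\infty]$. -/

import Mathlib

open Set Filter Topology TopologicalSpace
open scoped ENNReal NNReal

/-- `AssouadSpectrumBound F θ α`: there are `C > 0` and `ρ > 0` such that for all `0 < R ≤ ρ` and all
`x ∈ F`, the set `B(x, R) ∩ F` is covered by at most `C (R / R^(1/θ))^α` closed balls of radius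
`R^(1/θ)`.  Here `Metric.externalCoveringNumber r E` is the minimal number of closed `r`-balls,
with centres anywhere in the ambient space, needed to cover `E`. -/
def AssouadSpectrumBound {X : Type*} [MetricSpace X] (F : Set X) (θ α : ℝ) : Prop :=
  ∃ C > (0 : ℝ), ∃ ρ > (0 : ℝ), ∀ R : ℝ, 0 < R → R ≤ ρ → ∀ x ∈ F,
    ((Metric.externalCoveringNumber (R ^ (1 / θ)).toNNReal (Metric.ball x R ∩ F) : ℕ∞) : ℝ≥0∞) ≤
      ENNReal.ofReal (C * (R / R ^ (1 / θ)) ^ α)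

/-- The Assouad spectrum `dim_A^θ F`, the infimum of the admissible real exponents `α`, taken in the
extended reals (so that it is `⊤` if there is no admissible exponent). -/
noncomputable def assouadSpectrum {X : Type*} [MetricSpace X] (F : Set X) (θ : ℝ) : EReal :=
  ⨅ (α : ℝ) (_ : AssouadSpectrumBound F θ α), (α : EReal)

/-- The map `(F, θ) ↦ dim_A^θ F` on `𝒦(X) × (0,1)`, where `𝒦(X)` is the space of nonempty compact
subsets of `X` with the Hausdorff metric. -/
noncomputable def assouadSpectrumMap (X : Type*) [MetricSpace X] :
    NonemptyCompacts X × Ioo (0 : ℝ) 1 → EReal :=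
  fun p => assouadSpectrum (p.1 : Set X) (p.2 : ℝ)

/-- The Baire hierarchy: class `0` consists of the continuous functions, class `n + 1` of the pointwise
limits of sequences of functions of class `n`. -/
def IsBaireClass {A B : Type*} [TopologicalSpace A] [TopologicalSpace B] : ℕ → (A → B) → Prop
  | 0, f => Continuous f
  | n + 1, f => ∃ g : ℕ → A → B, (∀ k, IsBaireClass n (g k)) ∧
      ∀ a, Tendsto (fun k => g k a) atTop (𝓝 (f a))

/-!
Requiring the covering bound with constant `1` at all scales `R ≤ 1 / (n + 1)` is a closed condition
on `(F, θ, α)`: being coverable by `k` closed balls is the projection of a closed condition along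
the compact space of `k`-tuples of centres. The least exponent allowed at stage `n`, capped at `n`,
is therefore lower semicontinuous in `(F, θ)`, hence of Baire class `1` by Lipschitz regularization.
As `n → ∞` these functions converge to the Assouad spectrum, because `R / R ^ (1 / θ) → ∞` as
`R → 0`, so that an arbitrarily small increase of the exponent absorbs any constant.

Class `1` fails on every proper space `X` carrying an Ahlfors `s`-regular measure with `s > 0`. For
fixed `θ` the spectrum is `0` at finite sets and at least `s` at sets with nonempty interior. Both
kinds of sets are dense in the complete space `𝒦(X)`, which the Baire category theorem forbids for a
function of class `1`.
-/

namespace IsBaireClass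

variable {A B D : Type*} [TopologicalSpace A] [TopologicalSpace B] [TopologicalSpace D]
  {n : ℕ} {f : A → B}

theorem comp_continuous (hf : IsBaireClass n f) {g : D → A} (hg : Continuous g) :
    IsBaireClass n (f ∘ g) := by
  induction n generalizing f with
  | zero => exact Continuous.comp hf hg
  | succ n ih =>
    obtain ⟨u, hu, hlim⟩ := hf
    exact ⟨fun k => u k ∘ g, fun k => ih (hu k), fun a => hlim (g a)⟩

theorem continuous_comp (hf : IsBaireClass n f) {g : B → D} (hg : Continuous g) :
    IsBaireClass n (g ∘ f) := by
  induction n generalizing f with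
  | zero => exact Continuous.comp hg hf
  | succ n ih =>
    obtain ⟨u, hu, hlim⟩ := hf
    exact ⟨fun k => g ∘ u k, fun k => ih (hu k), fun a => (hg.tendsto _).comp (hlim a)⟩

theorem borel_measurable [PseudoMetrizableSpace B] (hf : IsBaireClass n f) :
    @Measurable A B (borel A) (borel B) f := by
  borelize A B
  induction n generalizing f with
  | zero => exact Continuous.measurable hf
  | succ n ih =>
    obtain ⟨u, hu, hlim⟩ := hf
    exact measurable_of_tendsto_metrizable (fun k => ih (hu k)) (tendsto_pi_nhds.2 hlim)

end IsBaireClass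

theorem isGδ_setOf_frequently_mem {A : Type*} [TopologicalSpace A] {U : ℕ → Set A}
    (hU : ∀ k, IsOpen (U k)) : IsGδ {x | ∃ᶠ k in atTop, x ∈ U k} := by
  have h : {x | ∃ᶠ k in atTop, x ∈ U k} = ⋂ m, ⋃ k ≥ m, U k := by
    ext x
    simp [frequently_atTop]
  rw [h]
  exact .iInter_of_isOpen fun m => isOpen_biUnion fun k _ => hU k

theorem not_isBaireClass_one_of_dense {A B : Type*} [TopologicalSpace A] [BaireSpace A] [Nonempty A]
    [TopologicalSpace B] [LinearOrder B] [OrderTopology B] [DenselyOrdered B] {f : A → B} {a b : B}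
    (hab : a < b) (ha : Dense {x | f x ≤ a}) (hb : Dense {x | b ≤ f x}) :
    ¬ IsBaireClass 1 f := by
  rintro ⟨g, hg, hlim⟩
  replace hg : ∀ k, Continuous (g k) := hg
  obtain ⟨c, hac, hcb⟩ := exists_between hab
  obtain ⟨d, hcd, hdb⟩ := exists_between hcb
  have low_dense : Dense {x | ∃ᶠ k in atTop, g k x < c} := ha.mono fun x hx =>
    ((hlim x).eventually_lt_const (lt_of_le_of_lt hx hac)).frequently
  have high_dense : Dense {x | ∃ᶠ k in atTop, d < g k x} := hb.mono fun x hx =>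
    ((hlim x).eventually_const_lt (lt_of_lt_of_le hdb hx)).frequently
  have low_Gδ : IsGδ {x | ∃ᶠ k in atTop, g k x < c} :=
    isGδ_setOf_frequently_mem fun k => isOpen_lt (hg k) continuous_const
  have high_Gδ : IsGδ {x | ∃ᶠ k in atTop, d < g k x} :=
    isGδ_setOf_frequently_mem fun k => isOpen_lt continuous_const (hg k)
  obtain ⟨x, hlow, hhigh⟩ := (low_dense.inter_of_Gδ low_Gδ high_Gδ high_dense).nonempty
  have hfc : f x ≤ c := le_of_tendsto_of_frequently (hlim x) (hlow.mono fun _ => le_of_lt)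
  have hdf : d ≤ f x := ge_of_tendsto_of_frequently (hlim x) (hhigh.mono fun _ => le_of_lt)
  exact (hdf.trans hfc).not_gt hcd

section LipschitzRegularization

variable {Z : Type*} [PseudoMetricSpace Z] {f : Z → ℝ}

/-- The Lipschitz regularization (Pasch–Hausdorff envelope) of `f`: the largest `k`-Lipschitz
function below `f`, provided that `f` is bounded below. -/
noncomputable def lipschitzRegularization (f : Z → ℝ) (k : ℝ≥0) (z : Z) : ℝ :=
  ⨅ w, (f w + k * dist z w)

theorem lipschitzRegularization_le_add (hf : BddBelow (range f)) (k : ℝ≥0) (z w : Z) :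
    lipschitzRegularization f k z ≤ f w + k * dist z w := by
  obtain ⟨m, hm⟩ := hf
  refine ciInf_le ⟨m, ?_⟩ w
  rintro _ ⟨w, rfl⟩
  exact le_add_of_le_of_nonneg (hm ⟨w, rfl⟩) (by positivity)

theorem lipschitzWith_lipschitzRegularization (hf : BddBelow (range f)) (k : ℝ≥0) :
    LipschitzWith k (lipschitzRegularization f k) := by
  refine .of_le_add_mul k fun z z' => ?_
  have : Nonempty Z := ⟨z⟩
  rw [← sub_le_iff_le_add]
  refine le_ciInf fun w => sub_le_iff_le_add.2 ?_
  calc lipschitzRegularization f k z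
      ≤ f w + k * dist z w := lipschitzRegularization_le_add hf k z w
    _ ≤ f w + k * (dist z z' + dist z' w) := by gcongr; exact dist_triangle _ _ _
    _ = f w + k * dist z' w + k * dist z z' := by ring

theorem tendsto_lipschitzRegularization (hlsc : LowerSemicontinuous f) (hf : BddBelow (range f))
    (z : Z) : Tendsto (fun k : ℕ => lipschitzRegularization f k z) atTop (𝓝 (f z)) := by
  have : Nonempty Z := ⟨z⟩
  have le_self (k : ℕ) : lipschitzRegularization f k z ≤ f z := by
    simpa using lipschitzRegularization_le_add hf k z z
  refine tendsto_order.2 ⟨fun a ha => ?_, fun a ha => .of_forall fun k => (le_self k).trans_lt ha⟩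
  obtain ⟨b, hab, hbf⟩ := exists_between ha
  obtain ⟨δ, hδ, hnear⟩ := Metric.eventually_nhds_iff.1 (hlsc z b hbf)
  obtain ⟨m, hm⟩ := hf
  filter_upwards [eventually_ge_atTop ⌈(b - m) / δ⌉₊] with k hk
  refine hab.trans_le (le_ciInf fun w => ?_)
  rcases lt_or_ge (dist w z) δ with hw | hw
  · exact le_add_of_le_of_nonneg (hnear hw).le (by positivity)
  · calc b = m + (b - m) / δ * δ := by field_simp; ring
      _ ≤ f w + k * dist z w := by
        rw [dist_comm z w]
        gcongr
        exacts [hm ⟨w, rfl⟩, Nat.ceil_le.1 hk]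

theorem isBaireClass_one_of_lowerSemicontinuous (hlsc : LowerSemicontinuous f)
    (hf : BddBelow (range f)) : IsBaireClass 1 f :=
  ⟨fun k => lipschitzRegularization f k,
    fun k => (lipschitzWith_lipschitzRegularization hf k).continuous,
    tendsto_lipschitzRegularization hlsc hf⟩

end LipschitzRegularization

theorem isClosed_setOf_forall_mem {X Z : Type*} [TopologicalSpace X] [TopologicalSpace Z]
    {K : Z → NonemptyCompacts X} (hK : Continuous K) {C : Set (X × Z)} (hC : IsClosed C) :
    IsClosed {z | ∀ x ∈ K z, (x, z) ∈ C} := by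
  rw [← isOpen_compl_iff, isOpen_iff_mem_nhds]
  intro z hz
  obtain ⟨x, hx, hxz⟩ : ∃ x ∈ K z, (x, z) ∉ C := by simpa using hz
  obtain ⟨U, V, hU, hV, hxU, hzV, hUV⟩ := isOpen_prod_iff.1 hC.isOpen_compl x z hxz
  have hmeet : ∀ᶠ w in 𝓝 z, ((K w : Set X) ∩ U).Nonempty :=
    hK.continuousAt.eventually
      ((NonemptyCompacts.isOpen_inter_nonempty_of_isOpen hU).mem_nhds ⟨x, hx, hxU⟩)
  filter_upwards [hmeet, hV.mem_nhds hzV] with w ⟨y, hy, hyU⟩ hwV hw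
  exact hUV ⟨hyU, hwV⟩ (hw y hy)

section CoveringNumber

open Metric

theorem exists_subset_range_fin_of_encard_le {X : Type*} [Nonempty X] {C : Set X} {k : ℕ}
    (h : C.encard ≤ k) : ∃ c : Fin k → X, C ⊆ range c := by
  have hfin : C.Finite := finite_of_encard_le_coe h
  have := hfin.fintype
  have hcard : Fintype.card C ≤ Fintype.card (Fin k) := by
    rw [encard_eq_coe_toFinset_card, Nat.cast_le, toFinset_card] at h
    simpa using h
  obtain ⟨e⟩ := Function.Embedding.nonempty_of_card_le hcard
  refine ⟨Function.extend e (↑) fun _ => Classical.arbitrary X, fun x hx => ⟨e ⟨x, hx⟩, ?_⟩⟩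
  rw [e.injective.extend_apply]

theorem externalCoveringNumber_le_natCast_iff {X : Type*} [PseudoMetricSpace X] [Nonempty X]
    {r : ℝ≥0} {A : Set X} {k : ℕ} :
    externalCoveringNumber r A ≤ k ↔ ∃ c : Fin k → X, A ⊆ ⋃ i, closedBall (c i) r := by
  constructor
  · intro h
    have h' : externalCoveringNumber r A < k + 1 :=
      (ENat.lt_add_one_iff (ENat.natCast_ne_top k)).2 h
    simp only [externalCoveringNumber, iInf_lt_iff] at h'
    obtain ⟨C, hC, hcard⟩ := h'
    obtain ⟨c, hc⟩ := exists_subset_range_fin_of_encard_le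
      ((ENat.lt_add_one_iff (ENat.natCast_ne_top k)).1 hcard)
    refine ⟨c, (isCover_iff_subset_iUnion_closedBall.1 hC).trans ?_⟩
    rw [← biUnion_range (f := c) (g := fun y => closedBall y (r : ℝ))]
    exact biUnion_mono hc fun _ _ => Subset.rfl
  · rintro ⟨c, hc⟩
    rw [← biUnion_range (f := c) (g := fun y => closedBall y (r : ℝ)),
      ← isCover_iff_subset_iUnion_closedBall] at hc
    calc externalCoveringNumber r A ≤ (range c).encard := hc.externalCoveringNumber_le_encard
      _ ≤ (univ : Set (Fin k)).encard := by rw [← image_univ]; exact encard_image_le _ _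
      _ = k := by simp

theorem isClosed_setOf_externalCoveringNumber_ball_inter_le (X : Type*) [PseudoMetricSpace X]
    [CompactSpace X] (R : ℝ) (k : ℕ) :
    IsClosed {p : NonemptyCompacts X × X × ℝ≥0 |
      externalCoveringNumber p.2.2 (ball p.2.1 R ∩ p.1) ≤ k} := by
  let T : Set ((NonemptyCompacts X × X × ℝ≥0) × (Fin k → X)) :=
    {z | ∀ y ∈ z.1.1, R ≤ dist y z.1.2.1 ∨ ∃ i, dist y (z.2 i) ≤ z.1.2.2}
  have hT : IsClosed T := by
    refine isClosed_setOf_forall_mem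
      (K := fun z : (NonemptyCompacts X × X × ℝ≥0) × (Fin k → X) => z.1.1) (by fun_prop)
      (C := {q | R ≤ dist q.1 q.2.1.2.1 ∨ ∃ i, dist q.1 (q.2.2 i) ≤ q.2.1.2.2}) ?_
    simp only [ofPred_or, ofPred_exists]
    exact (isClosed_le (by fun_prop) (by fun_prop)).union <|
      isClosed_iUnion_of_finite fun i => isClosed_le (by fun_prop) (by fun_prop)
  convert isClosedMap_fst_of_compactSpace _ hT
  ext ⟨F, x, r⟩
  have : Nonempty X := ⟨x⟩
  simp [T, externalCoveringNumber_le_natCast_iff, subset_def, or_iff_not_imp_left, imp.swap]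

theorem toENNReal_le_ofReal_iff {N : ℕ∞} {L : ℝ} :
    (N : ℝ≥0∞) ≤ ENNReal.ofReal L ↔ ∀ k : ℕ, k + 1 ≤ L ∨ N ≤ k := by
  induction N using ENat.recTopCoe with
  | top =>
    obtain ⟨k, hk⟩ := exists_nat_gt L
    simpa using ⟨k, by linarith⟩
  | coe n =>
    cases n with
    | zero => simp
    | succ n =>
      rw [ENat.toENNReal_coe, ENNReal.natCast_le_ofReal n.succ_ne_zero]
      refine ⟨fun h k => ?_, fun h => ?_⟩
      · rw [Nat.cast_le, or_iff_not_imp_right, not_le, Nat.lt_succ_iff]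
        exact fun hkn => (by exact_mod_cast Nat.succ_le_succ hkn : (k : ℝ) + 1 ≤ _).trans h
      · exact_mod_cast (h n).resolve_right (by simp [-Nat.cast_add])

end CoveringNumber

section Scales

variable {θ R : ℝ}

theorem div_rpow_eq_rpow_one_sub (hR : 0 < R) (t : ℝ) : R / R ^ t = R ^ (1 - t) := by
  rw [Real.rpow_sub hR, Real.rpow_one]

theorem one_le_div_rpow_one_div (hθ : θ ∈ Ioo (0 : ℝ) 1) (hR : 0 < R) (hR1 : R ≤ 1) :
    1 ≤ R / R ^ (1 / θ) := by
  rw [div_rpow_eq_rpow_one_sub hR]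
  exact Real.one_le_rpow_of_pos_of_le_one_of_nonpos hR hR1
    (sub_nonpos.2 ((one_lt_div hθ.1).2 hθ.2).le)

theorem rpow_one_div_le_self (hθ : θ ∈ Ioo (0 : ℝ) 1) (hR : 0 < R) (hR1 : R ≤ 1) :
    R ^ (1 / θ) ≤ R :=
  (one_le_div (Real.rpow_pos_of_pos hR _)).1 (one_le_div_rpow_one_div hθ hR hR1)

theorem tendsto_div_rpow_one_div_atTop (hθ : θ ∈ Ioo (0 : ℝ) 1) :
    Tendsto (fun R : ℝ => R / R ^ (1 / θ)) (𝓝[>] 0) atTop := by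
  refine (tendsto_rpow_neg_nhdsGT_zero (sub_neg.2 ((one_lt_div hθ.1).2 hθ.2))).congr' ?_
  filter_upwards [self_mem_nhdsWithin] with R hR
  exact (div_rpow_eq_rpow_one_sub hR _).symm

theorem le_of_eventually_mul_rpow_le {ι : Type*} {l : Filter ι} [l.NeBot] {q : ι → ℝ}
    (hq : Tendsto q l atTop) {c C s α : ℝ} (hc : 0 < c)
    (h : ∀ᶠ i in l, c * q i ^ s ≤ C * q i ^ α) : s ≤ α := by
  by_contra! hlt
  have growth : ∀ᶠ i in l, C / c < q i ^ (s - α) :=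
    ((tendsto_rpow_atTop (sub_pos.2 hlt)).comp hq).eventually_gt_atTop _
  obtain ⟨i, hle, hgt, hpos⟩ := (h.and (growth.and (hq.eventually_gt_atTop 0))).exists
  refine hle.not_gt ?_
  calc C * q i ^ α < c * q i ^ (s - α) * q i ^ α := by
        gcongr
        exact (div_lt_iff₀' hc).1 hgt
    _ = c * q i ^ s := by rw [mul_assoc, ← Real.rpow_add hpos, sub_add_cancel]

end Scales

section AssouadSpectrum

open Metric

variable {X : Type*} [MetricSpace X] {F : Set X} {θ α β ρ : ℝ}

theorem assouadSpectrumBound_iff_eventually :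
    AssouadSpectrumBound F θ α ↔ ∃ C > (0 : ℝ), ∀ᶠ R : ℝ in 𝓝[>] 0, ∀ x ∈ F,
      (externalCoveringNumber (R ^ (1 / θ)).toNNReal (ball x R ∩ F) : ℝ≥0∞) ≤
        ENNReal.ofReal (C * (R / R ^ (1 / θ)) ^ α) := by
  simp only [AssouadSpectrumBound, Filter.Eventually, mem_nhdsGT_iff_exists_Ioc_subset]
  simp [subset_def]

theorem AssouadSpectrumBound.nonneg (h : AssouadSpectrumBound F θ α) (hF : F.Nonempty)
    (hθ : θ ∈ Ioo (0 : ℝ) 1) : 0 ≤ α := by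
  obtain ⟨C, -, h⟩ := assouadSpectrumBound_iff_eventually.1 h
  obtain ⟨x, hx⟩ := hF
  refine le_of_eventually_mul_rpow_le (C := C) (tendsto_div_rpow_one_div_atTop hθ) one_pos ?_
  filter_upwards [h, self_mem_nhdsWithin] with R hR hR0
  have one_le : 1 ≤ externalCoveringNumber (R ^ (1 / θ)).toNNReal (ball x R ∩ F) :=
    Order.one_le_iff_pos.2 (externalCoveringNumber_pos_iff.2 ⟨x, mem_ball_self hR0, hx⟩)
  rw [Real.rpow_zero, mul_one, ← ENNReal.one_le_ofReal]
  exact le_trans (by exact_mod_cast one_le) (hR x hx)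

theorem assouadSpectrum_nonneg (hF : F.Nonempty) (hθ : θ ∈ Ioo (0 : ℝ) 1) :
    0 ≤ assouadSpectrum F θ :=
  le_iInf₂ fun _ hα => EReal.coe_nonneg.2 (hα.nonneg hF hθ)

theorem assouadSpectrum_le (h : AssouadSpectrumBound F θ α) : assouadSpectrum F θ ≤ α :=
  iInf₂_le α h

/-- `α` is an admissible exponent in the definition of the Assouad spectrum with constant `1` at all
scales `R ≤ ρ`. Fixing the constant and the scale makes this a closed condition on `(F, θ, α)`. -/
def UniformAssouadBound (F : Set X) (θ ρ α : ℝ) : Prop :=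
  ∀ R : ℝ, 0 < R → R ≤ ρ → ∀ x ∈ F,
    (externalCoveringNumber (R ^ (1 / θ)).toNNReal (ball x R ∩ F) : ℝ≥0∞) ≤
      ENNReal.ofReal ((R / R ^ (1 / θ)) ^ α)

namespace UniformAssouadBound

theorem mono (h : UniformAssouadBound F θ ρ α) (hθ : θ ∈ Ioo (0 : ℝ) 1) (hρ : ρ ≤ 1)
    (hαβ : α ≤ β) : UniformAssouadBound F θ ρ β := fun R hR hRρ x hx =>
  (h R hR hRρ x hx).trans <| ENNReal.ofReal_le_ofReal <|
    Real.rpow_le_rpow_of_exponent_le (one_le_div_rpow_one_div hθ hR (hRρ.trans hρ)) hαβ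

theorem assouadSpectrumBound (h : UniformAssouadBound F θ ρ α) (hρ : 0 < ρ) :
    AssouadSpectrumBound F θ α :=
  ⟨1, one_pos, ρ, hρ, by simpa only [UniformAssouadBound, one_mul] using h⟩

end UniformAssouadBound

theorem AssouadSpectrumBound.eventually_uniformAssouadBound (h : AssouadSpectrumBound F θ α)
    (hθ : θ ∈ Ioo (0 : ℝ) 1) (hαβ : α < β) : ∀ᶠ ρ in 𝓝[>] 0, UniformAssouadBound F θ ρ β := by
  obtain ⟨C, -, h⟩ := assouadSpectrumBound_iff_eventually.1 h
  have absorb : ∀ᶠ R : ℝ in 𝓝[>] 0, C ≤ (R / R ^ (1 / θ)) ^ (β - α) :=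
    ((tendsto_rpow_atTop (sub_pos.2 hαβ)).comp
      (tendsto_div_rpow_one_div_atTop hθ)).eventually_ge_atTop C
  obtain ⟨ρ₀, hρ₀, hbound⟩ := mem_nhdsGT_iff_exists_Ioc_subset.1 (h.and absorb)
  filter_upwards [Ioc_mem_nhdsGT hρ₀] with ρ hρ R hR hRρ x hx
  obtain ⟨hcover, hC⟩ := hbound ⟨hR, hRρ.trans hρ.2⟩
  have hq : 0 < R / R ^ (1 / θ) := by positivity
  refine (hcover x hx).trans (ENNReal.ofReal_le_ofReal ?_)
  calc C * (R / R ^ (1 / θ)) ^ α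
      ≤ (R / R ^ (1 / θ)) ^ (β - α) * (R / R ^ (1 / θ)) ^ α := by gcongr
    _ = (R / R ^ (1 / θ)) ^ β := by rw [← Real.rpow_add hq, sub_add_cancel]

theorem isClosed_setOf_forall_externalCoveringNumber_le (X : Type*) [PseudoMetricSpace X]
    [CompactSpace X] {R : ℝ} (hR : 0 < R) :
    IsClosed {q : (NonemptyCompacts X × Ioo (0 : ℝ) 1) × ℝ | ∀ x ∈ q.1.1,
      (externalCoveringNumber (R ^ (1 / (q.1.2 : ℝ))).toNNReal (ball x R ∩ q.1.1) : ℝ≥0∞) ≤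
        ENNReal.ofReal ((R / R ^ (1 / (q.1.2 : ℝ))) ^ q.2)} := by
  have radius_cont : Continuous fun θ : Ioo (0 : ℝ) 1 => R ^ (1 / (θ : ℝ)) :=
    .rpow continuous_const (.div continuous_const continuous_subtype_val fun θ => θ.2.1.ne')
      fun _ => .inl hR.ne'
  let r (z : X × (NonemptyCompacts X × Ioo (0 : ℝ) 1) × ℝ) : ℝ := R ^ (1 / (z.2.1.2 : ℝ))
  have hr : Continuous r := radius_cont.comp (by fun_prop)
  have r_pos z : 0 < r z := Real.rpow_pos_of_pos hR _
  refine isClosed_setOf_forall_mem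
    (K := fun q : (NonemptyCompacts X × Ioo (0 : ℝ) 1) × ℝ => q.1.1) (by fun_prop)
    (C := {z | (externalCoveringNumber (r z).toNNReal (ball z.1 R ∩ z.2.1.1) : ℝ≥0∞) ≤
      ENNReal.ofReal ((R / r z) ^ z.2.2)}) ?_
  simp only [toENNReal_le_ofReal_iff, ofPred_forall, ofPred_or]
  refine isClosed_iInter fun k => (isClosed_le continuous_const ?_).union ?_
  · exact (continuous_const.div hr fun z => (r_pos z).ne').rpow (by fun_prop)
      fun z => .inl (div_pos hR (r_pos z)).ne'
  · have : Continuous fun z => (z.2.1.1, z.1, (r z).toNNReal) := by fun_prop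
    exact (isClosed_setOf_externalCoveringNumber_ball_inter_le X R k).preimage this

theorem isClosed_setOf_uniformAssouadBound (X : Type*) [MetricSpace X] [CompactSpace X] (ρ : ℝ) :
    IsClosed {q : (NonemptyCompacts X × Ioo (0 : ℝ) 1) × ℝ |
      UniformAssouadBound (q.1.1 : Set X) q.1.2 ρ q.2} := by
  convert isClosed_iInter fun R : Ioc 0 ρ =>
    isClosed_setOf_forall_externalCoveringNumber_le X R.2.1
  ext
  simp [UniformAssouadBound]

end AssouadSpectrum

section Approximation

variable {X : Type*} [MetricSpace X] {p : NonemptyCompacts X × Ioo (0 : ℝ) 1} {n : ℕ}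

/-- The nonnegative exponents admissible with constant `1` at all scales up to `1 / (n + 1)`. All
exponents from `n` on are added, so that the infimum is never taken over the empty set. -/
def approxExponents (n : ℕ) (p : NonemptyCompacts X × Ioo (0 : ℝ) 1) : Set ℝ :=
  {α | 0 ≤ α ∧ (n ≤ α ∨ UniformAssouadBound (p.1 : Set X) p.2 (1 / (n + 1)) α)}

/-- The real-valued lower semicontinuous functions that converge to the Assouad spectrum. -/
noncomputable def assouadSpectrumApprox (n : ℕ) (p : NonemptyCompacts X × Ioo (0 : ℝ) 1) : ℝ :=
  sInf (approxExponents n p)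

theorem isClosed_setOf_mem_approxExponents (X : Type*) [MetricSpace X] [CompactSpace X] (n : ℕ) :
    IsClosed {q : (NonemptyCompacts X × Ioo (0 : ℝ) 1) × ℝ | q.2 ∈ approxExponents n q.1} :=
  (isClosed_le continuous_const continuous_snd).inter <|
    (isClosed_le continuous_const continuous_snd).union (isClosed_setOf_uniformAssouadBound X _)

variable [CompactSpace X]

theorem assouadSpectrumApprox_le_iff {α : ℝ} :
    assouadSpectrumApprox n p ≤ α ↔ α ∈ approxExponents n p := by
  have bdd : BddBelow (approxExponents n p) := ⟨0, fun _ h => h.1⟩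
  have nonempty : (approxExponents n p).Nonempty := ⟨n, n.cast_nonneg, .inl le_rfl⟩
  have closed : IsClosed (approxExponents n p) :=
    (isClosed_setOf_mem_approxExponents X n).preimage (Continuous.prodMk_right p)
  refine ⟨fun h => ?_, csInf_le bdd⟩
  obtain ⟨inf_nonneg, inf_mem⟩ := closed.csInf_mem nonempty bdd
  have hn : (1 : ℝ) / (n + 1) ≤ 1 := (div_le_one (by positivity)).2 (by simp)
  exact ⟨inf_nonneg.trans h, inf_mem.imp (fun hle => hle.trans h) fun hu => hu.mono p.2.2 hn h⟩

theorem isBaireClass_one_assouadSpectrumApprox (X : Type*) [MetricSpace X] [CompactSpace X]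
    (n : ℕ) : IsBaireClass 1 (assouadSpectrumApprox (X := X) n) := by
  refine isBaireClass_one_of_lowerSemicontinuous ?_ ⟨0, ?_⟩
  · rw [lowerSemicontinuous_iff_isClosed_epigraph]
    simpa only [assouadSpectrumApprox_le_iff] using isClosed_setOf_mem_approxExponents X n
  · rintro _ ⟨p, rfl⟩
    exact Real.sInf_nonneg fun _ h => h.1

theorem tendsto_assouadSpectrumApprox (p : NonemptyCompacts X × Ioo (0 : ℝ) 1) :
    Tendsto (fun n => (assouadSpectrumApprox n p : EReal)) atTop (𝓝 (assouadSpectrumMap X p)) := by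
  refine tendsto_order.2 ⟨fun a ha => ?_, fun a ha => ?_⟩
  · obtain ⟨α, haα, hα⟩ := EReal.lt_iff_exists_real_btwn.1 ha
    filter_upwards [(tendsto_natCast_atTop_atTop (R := ℝ)).eventually_gt_atTop α] with n hn
    refine haα.trans (EReal.coe_lt_coe (not_le.1 fun hle => ?_))
    rcases (assouadSpectrumApprox_le_iff.1 hle).2 with h | h
    · exact h.not_gt hn
    · exact hα.not_ge (assouadSpectrum_le (h.assouadSpectrumBound (by positivity)))
  · obtain ⟨β, hβ, hβa⟩ := EReal.lt_iff_exists_real_btwn.1 ha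
    obtain ⟨α, hα, hαβ⟩ : ∃ α, AssouadSpectrumBound (p.1 : Set X) p.2 α ∧ α < β := by
      simpa [assouadSpectrumMap, assouadSpectrum, iInf_lt_iff] using hβ
    have scale_tendsto : Tendsto (fun n : ℕ => 1 / ((n : ℝ) + 1)) atTop (𝓝[>] 0) :=
      tendsto_nhdsWithin_iff.2
        ⟨tendsto_one_div_add_atTop_nhds_zero_nat,
          .of_forall fun n => mem_Ioi.2 Nat.one_div_pos_of_nat⟩
    filter_upwards [scale_tendsto.eventually (hα.eventually_uniformAssouadBound p.2.2 hαβ)]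
      with n hn
    have hβ0 : 0 ≤ β := (hα.nonneg p.1.nonempty p.2.2).trans hαβ.le
    exact (EReal.coe_le_coe (assouadSpectrumApprox_le_iff.2 ⟨hβ0, .inr hn⟩)).trans_lt hβa

theorem isBaireClass_two_assouadSpectrumMap (X : Type*) [MetricSpace X] [CompactSpace X] :
    IsBaireClass 2 (assouadSpectrumMap X) :=
  ⟨fun n p => (assouadSpectrumApprox n p : EReal), fun n =>
    (isBaireClass_one_assouadSpectrumApprox X n).continuous_comp continuous_coe_real_ereal,
    tendsto_assouadSpectrumApprox⟩

theorem isBaireClass_two_of_coe_eq_assouadSpectrumMap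
    {f : NonemptyCompacts X × Ioo (0 : ℝ) 1 → ℝ}
    (hf : ∀ p, (f p : EReal) = assouadSpectrumMap X p) : IsBaireClass 2 f :=
  ⟨assouadSpectrumApprox, isBaireClass_one_assouadSpectrumApprox X, fun p =>
    EReal.tendsto_coe.1 (hf p ▸ tendsto_assouadSpectrumApprox p)⟩

end Approximation

section PackingMeasure

open Metric MeasureTheory

variable {X : Type*} [PseudoMetricSpace X] [MeasurableSpace X] {μ : Measure X} {r : ℝ≥0}
  {A T : Set X} {m M : ℝ≥0∞}

theorem packingNumber_mul_le_measure [OpensMeasurableSpace X]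
    (hm : ∀ y ∈ A, m ≤ μ (closedBall y (r / 2))) (hT : ∀ y ∈ A, closedBall y (r / 2) ⊆ T) :
    (packingNumber r A : ℝ≥0∞) * m ≤ μ T := by
  simp only [packingNumber, ENat.toENNReal_iSup, ENNReal.iSup_mul, iSup_le_iff]
  intro S hSA hS
  have disjoint : Pairwise (Function.onFun Disjoint fun y : S => closedBall (y : X) (r / 2)) := by
    intro y z hyz
    refine closedBall_disjoint_closedBall ?_
    have : ENNReal.ofReal r < ENNReal.ofReal (dist (y : X) z) := by
      simpa [edist_dist] using hS y.2 z.2 (Subtype.coe_injective.ne hyz)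
    simpa using (ENNReal.ofReal_lt_ofReal_iff_of_nonneg r.2).1 this
  calc (S.encard : ℝ≥0∞) * m = ∑' _ : S, m := (ENNReal.tsum_set_const S m).symm
    _ ≤ ∑' y : S, μ (closedBall (y : X) (r / 2)) := ENNReal.tsum_le_tsum fun y => hm y (hSA y.2)
    _ ≤ μ (⋃ y : S, closedBall (y : X) (r / 2)) :=
        tsum_meas_le_meas_iUnion_of_disjoint μ (fun _ => measurableSet_closedBall) disjoint
    _ ≤ μ T := measure_mono (iUnion_subset fun y => hT y (hSA y.2))

theorem measure_le_externalCoveringNumber_mul [Nonempty X] (hM0 : M ≠ 0)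
    (hM : ∀ y, μ (closedBall y r) ≤ M) : μ A ≤ externalCoveringNumber r A * M := by
  rcases eq_or_ne (externalCoveringNumber r A) ⊤ with htop | htop
  · simp [htop, ENNReal.top_mul hM0]
  obtain ⟨k, hk⟩ := ENat.ne_top_iff_exists.1 htop
  obtain ⟨c, hc⟩ := externalCoveringNumber_le_natCast_iff.1 hk.ge
  calc μ A ≤ ∑ i, μ (closedBall (c i) r) :=
        (measure_mono hc).trans (measure_iUnion_fintype_le μ _)
    _ ≤ ∑ _ : Fin k, M := Finset.sum_le_sum fun i _ => hM (c i)
    _ = externalCoveringNumber r A * M := by simp [← hk]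

end PackingMeasure

section AhlforsRegular

open Metric MeasureTheory

variable {X : Type*} [PseudoMetricSpace X] [MeasurableSpace X] {μ : Measure X} {s : ℝ}

/-- Ahlfors `s`-regularity of `μ`: at scales `r ≤ 1`, all closed balls of radius `r` have measure
comparable to `r ^ s`. -/
def IsAhlforsRegular (μ : Measure X) (s : ℝ) : Prop :=
  ∃ c > (0 : ℝ), ∃ C > (0 : ℝ), ∀ (x : X) (r : ℝ), 0 < r → r ≤ 1 →
    ENNReal.ofReal (c * r ^ s) ≤ μ (closedBall x r) ∧
      μ (closedBall x r) ≤ ENNReal.ofReal (C * r ^ s)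

namespace IsAhlforsRegular

theorem exists_externalCoveringNumber_le [OpensMeasurableSpace X] (h : IsAhlforsRegular μ s) :
    ∃ C > (0 : ℝ), ∀ (x : X) (r R : ℝ), 0 < r → r ≤ R → R ≤ 1 / 2 → ∀ A ⊆ ball x R,
      (externalCoveringNumber r.toNNReal A : ℝ≥0∞) ≤ ENNReal.ofReal (C * (R / r) ^ s) := by
  obtain ⟨c, hc, C, hC, hμ⟩ := h
  refine ⟨C / c * 4 ^ s, by positivity, fun x r R hr hrR hR2 A hA => ?_⟩
  have hR : 0 < R := hr.trans_le hrR
  have packing : (packingNumber r.toNNReal A : ℝ≥0∞) * ENNReal.ofReal (c * (r / 2) ^ s) ≤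
      μ (closedBall x (2 * R)) := by
    refine packingNumber_mul_le_measure (fun y _ => ?_) fun y hy => ?_ <;>
      rw [Real.coe_toNNReal r hr.le]
    · exact (hμ y (r / 2) (by positivity) (by linarith)).1
    · exact closedBall_subset_closedBall' (by linarith [mem_ball.1 (hA hy)])
  have cover_le_packing : externalCoveringNumber r.toNNReal A ≤ packingNumber r.toNNReal A :=
    (externalCoveringNumber_le_coveringNumber _ _).trans (coveringNumber_le_packingNumber _ _)
  calc (externalCoveringNumber r.toNNReal A : ℝ≥0∞)
      ≤ packingNumber r.toNNReal A := by exact_mod_cast cover_le_packing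
    _ ≤ ENNReal.ofReal (C * (2 * R) ^ s) / ENNReal.ofReal (c * (r / 2) ^ s) :=
        (ENNReal.le_div_iff_mul_le (.inl (ENNReal.ofReal_pos.2 (by positivity)).ne')
          (.inl ENNReal.ofReal_ne_top)).2 <|
          packing.trans (hμ x (2 * R) (by positivity) (by linarith)).2
    _ = ENNReal.ofReal (C / c * 4 ^ s * (R / r) ^ s) := by
        rw [← ENNReal.ofReal_div_of_pos (by positivity), mul_div_mul_comm,
          ← Real.div_rpow (by positivity) (by positivity), mul_assoc,
          ← Real.mul_rpow (by positivity) (by positivity)]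
        congr 3
        field_simp
        norm_num

theorem exists_le_externalCoveringNumber (h : IsAhlforsRegular μ s) :
    ∃ c > (0 : ℝ), ∀ (x : X) (r R : ℝ), 0 < r → r ≤ 1 → 0 < R → R ≤ 1 → ∀ A ⊇ closedBall x R,
      ENNReal.ofReal (c * (R / r) ^ s) ≤ externalCoveringNumber r.toNNReal A := by
  obtain ⟨c, hc, C, hC, hμ⟩ := h
  refine ⟨c / C, by positivity, fun x r R hr hr1 hR hR1 A hA => ?_⟩
  have : Nonempty X := ⟨x⟩
  have ball_pos : 0 < ENNReal.ofReal (C * r ^ s) := ENNReal.ofReal_pos.2 (by positivity)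
  calc ENNReal.ofReal (c / C * (R / r) ^ s)
      = ENNReal.ofReal (c * R ^ s) / ENNReal.ofReal (C * r ^ s) := by
        rw [← ENNReal.ofReal_div_of_pos (by positivity), mul_div_mul_comm,
          Real.div_rpow hR.le hr.le]
    _ ≤ externalCoveringNumber r.toNNReal A := by
        refine ENNReal.div_le_of_le_mul ?_
        calc ENNReal.ofReal (c * R ^ s) ≤ μ (closedBall x R) := (hμ x R hR hR1).1
          _ ≤ μ A := measure_mono hA
          _ ≤ externalCoveringNumber r.toNNReal A * ENNReal.ofReal (C * r ^ s) :=
            measure_le_externalCoveringNumber_mul ball_pos.ne' fun y => by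
              rw [Real.coe_toNNReal r hr.le]
              exact (hμ y r hr hr1).2

end IsAhlforsRegular

end AhlforsRegular

theorem dense_setOf_interior_nonempty (X : Type*) [MetricSpace X] [ProperSpace X] :
    Dense {F : NonemptyCompacts X | (interior (F : Set X)).Nonempty} := by
  intro F
  refine Metric.mem_closure_iff.2 fun ε hε => ?_
  let G : NonemptyCompacts X :=
    ⟨⟨Metric.cthickening (ε / 2) F, F.isCompact.cthickening⟩,
      F.nonempty.mono (Metric.self_subset_cthickening _)⟩
  refine ⟨G, ?_, ?_⟩
  · exact (F.nonempty.mono (Metric.self_subset_thickening (half_pos hε) _)).mono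
      (Metric.thickening_subset_interior_cthickening _ _)
  · rw [Metric.NonemptyCompacts.dist_eq]
    refine (Metric.hausdorffDist_le_of_mem_dist (half_pos hε).le (fun x hx => ?_)
      fun x hx => ?_).trans_lt (half_lt_self hε)
    · exact ⟨x, Metric.self_subset_cthickening _ hx, by simpa using (half_pos hε).le⟩
    · simpa [G, F.isCompact.cthickening_eq_biUnion_closedBall (half_pos hε).le] using hx

theorem assouadSpectrumBound_zero_of_finite {X : Type*} [MetricSpace X] {F : Set X}
    (hF : F.Finite) (θ : ℝ) : AssouadSpectrumBound F θ 0 := by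
  refine ⟨F.ncard + 1, by positivity, 1, one_pos, fun R _ _ x _ => ?_⟩
  have card_le : Metric.externalCoveringNumber (R ^ (1 / θ)).toNNReal (Metric.ball x R ∩ F) ≤
      F.ncard :=
    calc _ ≤ (Metric.ball x R ∩ F).encard := Metric.externalCoveringNumber_le_encard_self _
      _ ≤ F.encard := encard_le_encard inter_subset_right
      _ = F.ncard := hF.cast_ncard_eq.symm
  calc _ ≤ (F.ncard : ℝ≥0∞) := by exact_mod_cast card_le
    _ ≤ _ := by
      rw [Real.rpow_zero, mul_one, ← ENNReal.ofReal_natCast]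
      exact ENNReal.ofReal_le_ofReal (by simp)

namespace IsAhlforsRegular

open Metric MeasureTheory

variable {X : Type*} [MetricSpace X] [MeasurableSpace X] {μ : Measure X} {s θ α : ℝ} {F : Set X}

theorem assouadSpectrumBound [OpensMeasurableSpace X] (h : IsAhlforsRegular μ s) (F : Set X)
    (hθ : θ ∈ Ioo (0 : ℝ) 1) : AssouadSpectrumBound F θ s := by
  obtain ⟨C, hC, hcover⟩ := h.exists_externalCoveringNumber_le
  exact ⟨C, hC, 1 / 2, by norm_num, fun R hR hR2 x _ => hcover x _ R (by positivity)
    (rpow_one_div_le_self hθ hR (by linarith)) hR2 _ inter_subset_left⟩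

theorem le_of_assouadSpectrumBound (h : IsAhlforsRegular μ s) (hF : (interior F).Nonempty)
    (hθ : θ ∈ Ioo (0 : ℝ) 1) (hα : AssouadSpectrumBound F θ α) : s ≤ α := by
  obtain ⟨c, hc, hlower⟩ := h.exists_le_externalCoveringNumber
  obtain ⟨C, hC, hupper⟩ := assouadSpectrumBound_iff_eventually.1 hα
  obtain ⟨x, hx⟩ := hF
  obtain ⟨ε, hε, hball⟩ := Metric.isOpen_iff.1 isOpen_interior x hx
  refine le_of_eventually_mul_rpow_le (c := c / 2 ^ s) (C := C)
    (tendsto_div_rpow_one_div_atTop hθ) (by positivity) ?_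
  filter_upwards [hupper, Ioc_mem_nhdsGT hε, Ioc_mem_nhdsGT one_pos]
    with R hcover ⟨hR, hRε⟩ ⟨_, hR1⟩
  have ball_subset : closedBall x (R / 2) ⊆ ball x R ∩ F := subset_inter
    (closedBall_subset_ball (by linarith))
    ((closedBall_subset_ball (by linarith)).trans (hball.trans interior_subset))
  have radius_le_one : R ^ (1 / θ) ≤ 1 := (rpow_one_div_le_self hθ hR hR1).trans hR1
  have lower_le_upper := (hlower x (R ^ (1 / θ)) (R / 2) (by positivity) radius_le_one
    (by positivity) (by linarith) _ ball_subset).trans (hcover x (interior_subset hx))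
  rw [ENNReal.ofReal_le_ofReal_iff (by positivity), div_right_comm,
    Real.div_rpow (by positivity) (by norm_num)] at lower_le_upper
  rwa [div_mul_eq_mul_div₀, mul_div_assoc]

theorem le_assouadSpectrum (h : IsAhlforsRegular μ s) (hF : (interior F).Nonempty)
    (hθ : θ ∈ Ioo (0 : ℝ) 1) : s ≤ assouadSpectrum F θ :=
  le_iInf₂ fun _ hα => EReal.coe_le_coe (h.le_of_assouadSpectrumBound hF hθ hα)

theorem not_isBaireClass_one_assouadSpectrum [ProperSpace X] [Nonempty X]
    (h : IsAhlforsRegular μ s) (hs : 0 < s) (hθ : θ ∈ Ioo (0 : ℝ) 1) :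
    ¬ IsBaireClass 1 fun F : NonemptyCompacts X => assouadSpectrum (F : Set X) θ := by
  refine not_isBaireClass_one_of_dense (EReal.coe_lt_coe hs)
    (NonemptyCompacts.dense_setOfPred_finite.mono fun F hF => ?_)
    ((dense_setOf_interior_nonempty X).mono fun F hF => ?_)
  · exact assouadSpectrum_le (assouadSpectrumBound_zero_of_finite hF θ)
  · exact h.le_assouadSpectrum hF hθ

theorem not_isBaireClass_one_assouadSpectrumMap [ProperSpace X] [Nonempty X]
    (h : IsAhlforsRegular μ s) (hs : 0 < s) : ¬ IsBaireClass 1 (assouadSpectrumMap X) := by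
  have hθ : (1 / 2 : ℝ) ∈ Ioo (0 : ℝ) 1 := by norm_num
  intro hmap
  have slice := hmap.comp_continuous (Continuous.prodMk_left (⟨1 / 2, hθ⟩ : Ioo (0 : ℝ) 1))
  exact h.not_isBaireClass_one_assouadSpectrum hs hθ slice

theorem coe_toReal_assouadSpectrumMap [OpensMeasurableSpace X]
    (h : IsAhlforsRegular μ s) (p : NonemptyCompacts X × Ioo (0 : ℝ) 1) :
    ((assouadSpectrumMap X p).toReal : EReal) = assouadSpectrumMap X p :=
  EReal.coe_toReal
    (ne_top_of_le_ne_top (EReal.coe_ne_top s) (assouadSpectrum_le (h.assouadSpectrumBound _ p.2.2)))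
    (ne_bot_of_le_ne_bot EReal.zero_ne_bot (assouadSpectrum_nonneg p.1.nonempty p.2.2))

end IsAhlforsRegular

theorem isAhlforsRegular_volume_unitAddCircle :
    IsAhlforsRegular (MeasureTheory.volume : MeasureTheory.Measure UnitAddCircle) 1 := by
  refine ⟨1, one_pos, 2, two_pos, fun x r hr hr1 => ?_⟩
  rw [AddCircle.volume_closedBall, Real.rpow_one, one_mul]
  exact ⟨ENNReal.ofReal_le_ofReal (le_min hr1 (by linarith)),
    ENNReal.ofReal_le_ofReal (min_le_right _ _)⟩

theorem theorem5p1 :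
    (∀ (X : Type*) [MetricSpace X] [CompactSpace X] [Nonempty X],
      (IsBaireClass 2 (assouadSpectrumMap X) ∧
        @Measurable _ _ (borel (NonemptyCompacts X × Ioo (0 : ℝ) 1)) (borel EReal)
          (assouadSpectrumMap X)) ∧
      ∀ f : NonemptyCompacts X × Ioo (0 : ℝ) 1 → ℝ,
        (∀ p, (f p : EReal) = assouadSpectrumMap X p) →
          IsBaireClass 2 f ∧
          @Measurable _ _ (borel (NonemptyCompacts X × Ioo (0 : ℝ) 1)) (borel ℝ) f) ∧
    (∃ (X : Type) (_ : MetricSpace X) (_ : CompactSpace X) (_ : Nonempty X)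
      (f : NonemptyCompacts X × Ioo (0 : ℝ) 1 → ℝ),
        (∀ p, (f p : EReal) = assouadSpectrumMap X p) ∧
          ¬ IsBaireClass 1 f ∧ ¬ IsBaireClass 1 (assouadSpectrumMap X)) := by
  constructor
  · intro X _ _ _
    have hmap := isBaireClass_two_assouadSpectrumMap X
    refine ⟨⟨hmap, hmap.borel_measurable⟩, fun f hf => ?_⟩
    have hf₂ := isBaireClass_two_of_coe_eq_assouadSpectrumMap hf
    exact ⟨hf₂, hf₂.borel_measurable⟩
  · have regular := isAhlforsRegular_volume_unitAddCircle
    have not_one := regular.not_isBaireClass_one_assouadSpectrumMap one_pos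
    have coe_toReal := regular.coe_toReal_assouadSpectrumMap
    refine ⟨UnitAddCircle, inferInstance, inferInstance, inferInstance,
      fun p => (assouadSpectrumMap UnitAddCircle p).toReal, coe_toReal, fun hreal => not_one ?_,
      not_one⟩
    rw [← funext coe_toReal]
    exact hreal.continuous_comp continuous_coe_real_ereal
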